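/- For $r,\alpha,\mu>0$ let $\overline G_{r,\alpha,\mu}$ denote a random variable with the generalized gamma density $\frac{\alpha\mu^r}{\Gamma(r)}x^{\alpha r-1}e^{-\mu x^{\alpha}}$, $x>0$; put $G_{r,1}=\overline G_{r,1,1}$ (gamma), $G_{0,1}=0$, and $W_\alpha=\overline G_{1,\alpha,1}$ (Weibull). For $r\in(0,1]$ let $Z_{r,1}=(G_{r,1}+G_{1-r,1})/G_{r,1}$ with independent $G_{r,1}$ and $G_{1-r,1}$ (so $Z_{1,1}=1$). For $\delta\in(0,1]$ let $S_{\delta,1}$ be the positive strictly stable random variable with characteristic exponent $\delta$, that is, with characteristic function $t\mapsto\exp\{-|t|^{\delta}e^{-\frac{i\pi\delta}{2}\operatorname{sign}t}\}$. Let $r\in(0,1]$, $\lambda>0$, $\alpha>0$, $\gamma>0$ and $\alpha\gamma\in(0,1]$, and let $$F(x;r,\alpha,\gamma,\lambda)=\mathsf P\Big(\frac{\overline G_{r,\alpha\gamma,\lambda}}{W_\alpha}<x\Big),\qquad x\in\mathbb R,$$ where $\overline G_{r,\alpha\gamma,\lambda}$ and $W_\alpha$ are independent. Then the distribution function $F(x;r,\alpha,\gamma,\lambda)$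 is mixed exponential: it vanishes for $x<0$, and $$1-F(x;r,\alpha,\gamma,\lambda)=\int_0^\infty e^{-ux}\,dA(u),\qquad x\ge 0,$$ where $A(u)=\mathsf P\big(\lambda^{1/(\alpha\gamma)}\,W_\alpha\,S_{\alpha\gamma,1}\,Z_{r,1}^{1/(\alpha\gamma)}<u\big)$, $W_\alpha$, $S_{\alpha\gamma,1}$ and $Z_{r,1}$ being independent; the law $A$ is a probability distribution concentrated on $(0,\infty)$. -/

import Mathlib

open MeasureTheory ProbabilityTheory

noncomputable section

namespace MixedExp

/-- The generalized gamma density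
`g*(x; r, γ, μ) = |γ| μ ^ r / Γ(r) * x ^ (γ r - 1) * exp (-μ x ^ γ)` on the positive half-line. -/
def ggPDF (r γ μ x : ℝ) : ℝ :=
  if 0 < x then
    |γ| * μ ^ r / Real.Gamma r * x ^ (γ * r - 1) * Real.exp (-(μ * x ^ γ))
  else 0

/-- The generalized gamma distribution with parameters `r > 0`, `γ ≠ 0`, `μ > 0`. -/
def ggMeasure (r γ μ : ℝ) : Measure ℝ :=
  volume.withDensity fun x => ENNReal.ofReal (ggPDF r γ μ x)

/-- The Weibull distribution with shape `γ > 0`. -/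
def weibullMeasure (γ : ℝ) : Measure ℝ := ggMeasure 1 γ 1

/-- The gamma distribution with shape `r ≥ 0` and parameter `μ > 0`; the gamma distribution
with shape `0` is the point mass at `0`. -/
def gammaLaw (r μ : ℝ) : Measure ℝ :=
  if r = 0 then Measure.dirac 0 else ggMeasure r 1 μ

/-- The law of `μ * (G + G') / G`, where `G` and `G'` are independent and have the gamma
distributions with shapes `r` and `1 - r` and parameter `1` (`0 < r ≤ 1`, `μ > 0`).
For `r = 1` it is the point mass at `μ`. -/
def zMeasure (r μ : ℝ) : Measure ℝ :=
  ((gammaLaw r 1).prod (gammaLaw (1 - r) 1)).map fun p => μ * (p.1 + p.2) / p.1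

/-- `ν` is the strictly stable law with characteristic exponent `δ` and asymmetry parameter
`θ`: the probability measure with characteristic function
`t ↦ exp (-|t| ^ δ * exp (-(i π θ δ / 2) * sign t))`. -/
structure IsStrictlyStable (δ θ : ℝ) (ν : Measure ℝ) : Prop where
  isProbabilityMeasure : IsProbabilityMeasure ν
  charFun_eq : ∀ t : ℝ, charFun ν t =
    Complex.exp (-(((|t| ^ δ : ℝ) : ℂ) *
      Complex.exp (-(Complex.I * ((Real.pi * θ * δ / 2 * Real.sign t : ℝ) : ℂ)))))

/-- `ν` is the one-sided (positive) strictly stable law with characteristic exponent `δ`,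
`0 < δ ≤ 1` (asymmetry parameter `1`). For `δ = 1` it is the point mass at `1`. -/
structure IsPositiveStrictlyStable (δ : ℝ) (ν : Measure ℝ) : Prop
    extends IsStrictlyStable δ 1 ν where
  positive : ν (Set.Iic 0) = 0

/-- The law of `M = G / W`, where `G` and `W` are independent, `G` has the generalized gamma
distribution with parameters `r, α γ, lam` and `W` has the Weibull distribution with
shape `α`. -/
def limitLaw (r α γ lam : ℝ) : Measure ℝ :=
  ((ggMeasure r (α * γ) lam).prod (weibullMeasure α)).map fun p => p.1 / p.2

/-- The distribution function `F(x; r, α, γ, lam) = P(M < x)`. -/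
def limitDF (r α γ lam x : ℝ) : ℝ := (limitLaw r α γ lam).real (Set.Iio x)

/-- `F` is a mixed exponential distribution function with mixing law `A`: `A` is a probability
measure concentrated on `(0, ∞)`, `F` vanishes on the negative half-line, and
`1 - F x = ∫₀^∞ exp (-u x) dA(u)` for `x ≥ 0`. -/
structure IsMixedExponential (F : ℝ → ℝ) (A : Measure ℝ) : Prop where
  isProbabilityMeasure : IsProbabilityMeasure A
  positive : A (Set.Iic 0) = 0
  eq_zero_of_neg : ∀ x : ℝ, x < 0 → F x = 0
  tail_eq : ∀ x : ℝ, 0 ≤ x → 1 - F x = ∫ u in Set.Ici (0 : ℝ), Real.exp (-(u * x)) ∂A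

end MixedExp

end

namespace MixedExp

open scoped ENNReal

/-! Write `δ = α * γ`. Three facts combine. (1) If `G` has law `ggMeasure r δ lam`, then `lam * G ^
δ` is Gamma(`r`, 1), so conditioning on `W = w` turns the tail of `G / W` at `x` into the Gamma(`r`,
1) tail at `lam * (x * w) ^ δ`. (2) For `r ≤ 1` that tail is a Laplace transform: `P(G_{r,1} > s) =
E exp (-s Z)` (`lintegral_exp_neg_mul_zMeasure`). (3) The stable law has Laplace transform `exp (-s
^ δ)`, so `exp (-lam z (x w) ^ δ) = E exp (-(lam z) ^ (1/δ) x w S)`. Integrating over `Z` and `W`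
gives the mixture. Since the stable law is given by its characteristic function, (3) needs analytic
continuation from the imaginary axis to the right half-plane. -/

/-! ### Laplace transform of the one-sided stable law -/

open Complex in
-- The argument of `z ^ δ` is `δ * arg z`, which stays in `[-π/2, π/2]` because `δ ≤ 1`.
lemma re_cpow_ofReal_nonneg {δ : ℝ} (hδ0 : 0 < δ) (hδ1 : δ ≤ 1) {z : ℂ} (hz : 0 ≤ z.re) :
    0 ≤ (z ^ (δ : ℂ)).re := by
  rcases eq_or_ne z 0 with rfl | hz0
  · simp [Complex.zero_cpow (Complex.ofReal_ne_zero.2 hδ0.ne')]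
  · have harg := abs_le.1 (Complex.abs_arg_le_pi_div_two_iff.2 hz)
    have hpi := Real.pi_pos
    rw [Complex.cpow_def_of_ne_zero hz0, Complex.exp_re, Complex.im_mul_ofReal, Complex.log_im]
    refine mul_nonneg (Real.exp_pos _).le (Real.cos_nonneg_of_neg_pi_div_two_le_of_le ?_ ?_)
    · nlinarith
    · nlinarith

open Complex in
lemma mul_I_cpow_ofReal {δ : ℝ} (hδ : 0 < δ) (x : ℝ) :
    ((x : ℂ) * I) ^ (δ : ℂ) = ((|x| ^ δ : ℝ) : ℂ) *
      exp (I * ((Real.pi * δ / 2 * Real.sign x : ℝ) : ℂ)) := by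
  rcases lt_trichotomy x 0 with hx | rfl | hx
  · have h1 : (x : ℂ) * I = ((-x : ℝ) : ℂ) * (-I) := by push_cast; ring
    rw [h1, cpow_def_of_ne_zero (mul_ne_zero (ofReal_ne_zero.2 (neg_pos.2 hx).ne') (neg_ne_zero.2 I_ne_zero)),
      log_ofReal_mul (neg_pos.2 hx) (neg_ne_zero.2 I_ne_zero), log_neg_I, abs_of_neg hx, Real.rpow_def_of_pos (neg_pos.2 hx), Real.sign_of_neg hx,
      ofReal_exp, ← exp_add]
    congr 1
    push_cast; ring
  · simp [Complex.zero_cpow (Complex.ofReal_ne_zero.2 hδ.ne'), Real.zero_rpow hδ.ne']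
  · rw [cpow_def_of_ne_zero (mul_ne_zero (ofReal_ne_zero.2 hx.ne') I_ne_zero),
      log_ofReal_mul hx I_ne_zero, log_I, abs_of_pos hx, Real.rpow_def_of_pos hx, Real.sign_of_pos hx,
      ofReal_exp, ← exp_add]
    congr 1
    push_cast; ring

lemma ae_pos_of_measure_Iic_zero {ν : Measure ℝ} (hν : ν (Set.Iic 0) = 0) : ∀ᵐ x ∂ν, 0 < x := by
  rw [ae_iff]
  simpa [not_lt, Set.Iic] using hν

lemma integrable_exp_mul_of_nonpos {ν : Measure ℝ} [IsFiniteMeasure ν]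
    (hν : ν (Set.Iic 0) = 0) {t : ℝ} (ht : t ≤ 0) :
    Integrable (fun x => Real.exp (t * id x)) ν := by
  refine Integrable.of_bound (by fun_prop) 1 ?_
  filter_upwards [ae_pos_of_measure_Iic_zero hν] with x hx
  rw [Real.norm_of_nonneg (Real.exp_pos _).le]
  exact Real.exp_le_one_iff.2 (mul_nonpos_of_nonpos_of_nonneg ht hx.le)

lemma norm_complexMGF_neg_le_one {ν : Measure ℝ} [IsProbabilityMeasure ν]
    (hν : ν (Set.Iic 0) = 0) {z : ℂ} (hz : 0 ≤ z.re) : ‖complexMGF id ν (-z)‖ ≤ 1 := by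
  refine norm_complexMGF_le_mgf.trans ?_
  have : mgf id ν (-z).re ≤ ∫ _, (1 : ℝ) ∂ν := by
    refine integral_mono_ae (integrable_exp_mul_of_nonpos hν (by simpa using hz))
      (integrable_const _) ?_
    filter_upwards [ae_pos_of_measure_Iic_zero hν] with x hx
    exact Real.exp_le_one_iff.2 (mul_nonpos_of_nonpos_of_nonneg (by simpa using hz) hx.le)
  simpa using this

lemma diffContOnCl_complexMGF_neg {ν : Measure ℝ} [IsFiniteMeasure ν]
    (hν : ν (Set.Iic 0) = 0) :
    DiffContOnCl ℂ (fun z => complexMGF id ν (-z)) {z : ℂ | 0 < z.re} := by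
  constructor
  · have hsub : Set.Iio (0 : ℝ) ⊆ interior (integrableExpSet id ν) :=
      interior_maximal (fun t ht => integrable_exp_mul_of_nonpos hν (le_of_lt ht)) isOpen_Iio
    refine (differentiableOn_complexMGF (X := id) (μ := ν)).comp
      (differentiable_neg.differentiableOn) fun z hz => hsub ?_
    simpa using hz
  · rw [Complex.closure_setOfPred_lt_re]
    refine continuousOn_of_dominated (bound := fun _ => (1 : ℝ)) ?_ ?_ (integrable_const _) ?_
    · intro z _
      fun_prop
    · intro z hz
      filter_upwards [ae_pos_of_measure_Iic_zero hν] with x hx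
      rw [Complex.norm_exp]
      refine Real.exp_le_one_iff.2 ?_
      have hz' : 0 ≤ z.re := hz
      simp only [id, Complex.re_mul_ofReal, Complex.neg_re]
      nlinarith
    · filter_upwards with x
      fun_prop

lemma diffContOnCl_exp_neg_cpow {δ : ℝ} (hδ : 0 < δ) :
    DiffContOnCl ℂ (fun z => Complex.exp (-(z ^ (δ : ℂ)))) {z : ℂ | 0 < z.re} := by
  constructor
  · intro z hz
    have : z ∈ Complex.slitPlane := Or.inl hz
    exact ((differentiableAt_id.cpow_const this).neg.cexp).differentiableWithinAt
  · rw [Complex.closure_setOfPred_lt_re]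
    intro z hz
    exact ((Complex.continuousAt_cpow_const_of_re_pos (Or.inl hz)
      (by simpa using hδ)).neg.cexp).continuousWithinAt

/-- Both sides are bounded by 1 on the closed right half-plane and agree on the imaginary axis, so
Phragmén–Lindelöf with boundary bound 0 kills their difference. -/
lemma IsPositiveStrictlyStable.complexMGF_neg {δ : ℝ} {ν : Measure ℝ}
    (hν : IsPositiveStrictlyStable δ ν) (hδ0 : 0 < δ) (hδ1 : δ ≤ 1) {z : ℂ} (hz : 0 ≤ z.re) :
    complexMGF id ν (-z) = Complex.exp (-(z ^ (δ : ℂ))) := by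
  have := hν.isProbabilityMeasure
  have hbound : ∀ w : ℂ, 0 ≤ w.re →
      ‖complexMGF id ν (-w) - Complex.exp (-(w ^ (δ : ℂ)))‖ ≤ 2 := by
    intro w hw
    refine (norm_sub_le _ _).trans ?_
    have h1 := norm_complexMGF_neg_le_one hν.positive hw
    have h2 : ‖Complex.exp (-(w ^ (δ : ℂ)))‖ ≤ 1 := by
      rw [Complex.norm_exp]
      exact Real.exp_le_one_iff.2 (by simpa using re_cpow_ofReal_nonneg hδ0 hδ1 hw)
    linarith
  have key := PhragmenLindelof.right_half_plane_of_bounded_on_real (C := 0) (z := z)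
    ((diffContOnCl_complexMGF_neg hν.positive).sub (diffContOnCl_exp_neg_cpow hδ0))
    -- Coefficient 0 in the exponent reduces the growth condition to boundedness.
    ⟨1, one_lt_two, 0, ?_⟩ ?_ ?_ hz
  · exact sub_eq_zero.1 (norm_le_zero_iff.1 key)
  · refine Asymptotics.IsBigO.of_bound 2 ?_
    refine Filter.mem_inf_of_right ?_
    intro w hw
    simpa using hbound w (le_of_lt hw)
  · refine ⟨2, ?_⟩
    rw [Filter.eventually_map]
    filter_upwards [Filter.eventually_ge_atTop 0] with x hx
    exact hbound x (by simpa using hx)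
  · intro x
    have h := complexMGF_id_mul_I (μ := ν) (-x)
    rw [Complex.ofReal_neg, neg_mul] at h
    simp only [Pi.sub_apply]
    rw [h, hν.charFun_eq, mul_I_cpow_ofReal hδ0, abs_neg, Real.sign_neg]
    simp

lemma IsPositiveStrictlyStable.lintegral_exp_neg_mul {δ : ℝ} {ν : Measure ℝ}
    (hν : IsPositiveStrictlyStable δ ν) (hδ0 : 0 < δ) (hδ1 : δ ≤ 1) {s : ℝ} (hs : 0 ≤ s) :
    ∫⁻ x, ENNReal.ofReal (Real.exp (-(s * x))) ∂ν = ENNReal.ofReal (Real.exp (-(s ^ δ))) := by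
  have := hν.isProbabilityMeasure
  have hint := integrable_exp_mul_of_nonpos hν.positive (neg_nonpos.2 hs)
  have h := hν.complexMGF_neg hδ0 hδ1 (z := s) (by simpa using hs)
  rw [← Complex.ofReal_neg, complexMGF_ofReal, ← Complex.ofReal_cpow hs, ← Complex.ofReal_neg,
    ← Complex.ofReal_exp, Complex.ofReal_inj] at h
  simp only [id, neg_mul] at hint
  rw [← h, ← ofReal_integral_eq_lintegral_ofReal hint (ae_of_all _ fun _ => (Real.exp_pos _).le)]
  simp [mgf]

/-! ### Generalized gamma and gamma laws -/

lemma measurable_ggPDF (r γ μ : ℝ) : Measurable (ggPDF r γ μ) := by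
  unfold ggPDF
  exact Measurable.ite measurableSet_Ioi (by fun_prop) measurable_const

instance nullSingletonClass_ggMeasure (r γ μ : ℝ) : NullSingletonClass (ggMeasure r γ μ) := by
  unfold ggMeasure; infer_instance

instance sfinite_ggMeasure (r γ μ : ℝ) : SFinite (ggMeasure r γ μ) := by
  unfold ggMeasure; infer_instance

lemma lintegral_ggMeasure (r γ μ : ℝ) {f : ℝ → ℝ≥0∞} (hf : Measurable f) :
    ∫⁻ x, f x ∂ggMeasure r γ μ = ∫⁻ x in Set.Ioi 0, ENNReal.ofReal (|γ| * μ ^ r / Real.Gamma r *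
      x ^ (γ * r - 1) * Real.exp (-(μ * x ^ γ))) * f x := by
  rw [ggMeasure, lintegral_withDensity_eq_lintegral_mul _
    (measurable_ggPDF r γ μ).ennreal_ofReal hf, ← lintegral_indicator measurableSet_Ioi]
  congr 1 with x
  by_cases hx : 0 < x <;> simp [ggPDF, hx]

lemma ggMeasure_Iic_zero (r γ μ : ℝ) : ggMeasure r γ μ (Set.Iic 0) = 0 := by
  rw [← lintegral_indicator_one measurableSet_Iic,
    lintegral_ggMeasure _ _ _ (measurable_one.indicator measurableSet_Iic),
    setLIntegral_congr_fun (g := fun _ => 0) measurableSet_Ioi]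
  · simp
  · intro x hx
    have : ¬ x ≤ 0 := not_le.2 hx
    simp [this]

lemma ggMeasure_Ioi (r γ μ : ℝ) {y : ℝ} (hy : 0 ≤ y) :
    ggMeasure r γ μ (Set.Ioi y) = ∫⁻ x in Set.Ioi y, ENNReal.ofReal (|γ| * μ ^ r / Real.Gamma r *
      x ^ (γ * r - 1) * Real.exp (-(μ * x ^ γ))) := by
  rw [ggMeasure, withDensity_apply _ measurableSet_Ioi]
  refine setLIntegral_congr_fun measurableSet_Ioi fun x hx => ?_
  simp only [ggPDF, if_pos (lt_of_le_of_lt hy hx)]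

lemma image_mul_rpow_Ioi {γ μ : ℝ} (hγ : 0 < γ) (hμ : 0 < μ) {y : ℝ} (hy : 0 ≤ y) :
    (fun x : ℝ => μ * x ^ γ) '' Set.Ioi y = Set.Ioi (μ * y ^ γ) := by
  ext t
  constructor
  · rintro ⟨x, hx, rfl⟩
    exact mul_lt_mul_of_pos_left (Real.rpow_lt_rpow hy hx hγ) hμ
  · intro ht
    have ht0 : μ * y ^ γ < t := ht
    have h1 : y ^ γ < t / μ := by rwa [lt_div_iff₀' hμ]
    have h2 : 0 ≤ t / μ := (Real.rpow_nonneg hy γ).trans h1.le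
    refine ⟨(t / μ) ^ γ⁻¹, ?_, ?_⟩
    · exact (Real.lt_rpow_inv_iff_of_pos hy h2 hγ).2 h1
    · simp only [Real.rpow_inv_rpow h2 hγ.ne']
      field_simp

/-- Change of variables `t = μ * x ^ γ`. -/
lemma ggMeasure_Ioi_eq_gamma {r γ μ : ℝ} (hγ : 0 < γ) (hμ : 0 < μ) {y : ℝ} (hy : 0 ≤ y) :
    ggMeasure r γ μ (Set.Ioi y) = ggMeasure r 1 1 (Set.Ioi (μ * y ^ γ)) := by
  have hderiv : ∀ x ∈ Set.Ioi y, HasDerivWithinAt (fun x : ℝ => μ * x ^ γ)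
      (μ * (γ * x ^ (γ - 1))) (Set.Ioi y) x := fun x hx =>
    ((Real.hasDerivAt_rpow_const (Or.inl (hy.trans_lt hx).ne')).const_mul μ).hasDerivWithinAt
  have hinj : Set.InjOn (fun x : ℝ => μ * x ^ γ) (Set.Ioi y) := by
    intro a ha b hb hab
    exact Real.rpow_left_injOn hγ.ne' (hy.trans ha.le) (hy.trans hb.le)
      (mul_left_cancel₀ hμ.ne' hab)
  rw [ggMeasure_Ioi _ _ _ hy, ggMeasure_Ioi _ _ _ (by positivity),
    ← image_mul_rpow_Ioi hγ hμ hy,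
    lintegral_image_eq_lintegral_abs_deriv_mul measurableSet_Ioi hderiv hinj]
  refine setLIntegral_congr_fun measurableSet_Ioi fun x hx => ?_
  have hx0 : 0 < x := hy.trans_lt hx
  rw [← ENNReal.ofReal_mul (abs_nonneg _)]
  congr 1
  have h1 : 0 < x ^ (γ - 1) := Real.rpow_pos_of_pos hx0 _
  rw [abs_of_pos hγ, abs_of_pos (by positivity), abs_one, Real.one_rpow, one_mul, one_mul,
    Real.rpow_one, Real.mul_rpow hμ.le (by positivity), ← Real.rpow_mul hx0.le]
  have h2 : x ^ (γ * r - 1) = x ^ (γ - 1) * x ^ (γ * (r - 1)) := by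
    rw [← Real.rpow_add hx0]; ring_nf
  have h3 : μ ^ r = μ * μ ^ (r - 1) := by
    rw [Real.rpow_sub_one hμ.ne']; field_simp
  rw [h2, h3]
  ring_nf

lemma ggMeasure_one_one_eq_gammaMeasure (r : ℝ) : ggMeasure r 1 1 = gammaMeasure r 1 := by
  refine withDensity_congr_ae ?_
  -- The two densities use different conventions at 0, a null set.
  have h : ∀ᵐ x : ℝ, x ≠ 0 := by simp [ae_iff]
  filter_upwards [h] with x hx
  rw [gammaPDF, gammaPDFReal, ggPDF]
  rcases hx.lt_or_gt with hx | hx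
  · simp [hx.not_gt, hx.not_ge]
  · simp [hx, hx.le]

lemma isProbabilityMeasure_ggMeasure {r γ μ : ℝ} (hr : 0 < r) (hγ : 0 < γ) (hμ : 0 < μ) :
    IsProbabilityMeasure (ggMeasure r γ μ) := by
  have := isProbabilityMeasure_gammaMeasure hr one_pos
  have key : ∀ γ μ : ℝ, ggMeasure r γ μ Set.univ = ggMeasure r γ μ (Set.Ioi 0) := fun γ μ => by
    rw [← Set.Iic_union_Ioi (a := (0 : ℝ)), measure_union (Set.Iic_disjoint_Ioi le_rfl)
      measurableSet_Ioi, ggMeasure_Iic_zero, zero_add]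
  constructor
  rw [key, ggMeasure_Ioi_eq_gamma hγ hμ le_rfl, Real.zero_rpow hγ.ne', mul_zero, ← key,
    ggMeasure_one_one_eq_gammaMeasure, measure_univ]

lemma gammaLaw_of_pos {r : ℝ} (hr : 0 < r) (μ : ℝ) : gammaLaw r μ = ggMeasure r 1 μ :=
  if_neg hr.ne'

lemma isProbabilityMeasure_gammaLaw {r : ℝ} (hr : 0 ≤ r) :
    IsProbabilityMeasure (gammaLaw r 1) := by
  unfold gammaLaw
  split_ifs with h
  · infer_instance
  · exact isProbabilityMeasure_ggMeasure (lt_of_le_of_ne hr (Ne.symm h)) one_pos one_pos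

/-- Exponential tilting: for `q > 0`, multiplying the Gamma(`q`, 1) density by `exp (-t x)` gives
`(1 + t) ^ (-q)` times the Gamma(`q`, `1 + t`) density. -/
lemma lintegral_exp_neg_mul_gammaLaw {q t : ℝ} (hq : 0 ≤ q) (ht : 0 ≤ t) :
    ∫⁻ x, ENNReal.ofReal (Real.exp (-(t * x))) ∂gammaLaw q 1 =
      ENNReal.ofReal ((1 + t) ^ (-q)) := by
  unfold gammaLaw
  split_ifs with h
  · rw [lintegral_dirac]
    simp [h]
  · have hq0 : 0 < q := lt_of_le_of_ne hq (Ne.symm h)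
    have ht1 : 0 < 1 + t := by linarith
    have hΓ := Real.Gamma_pos_of_pos hq0
    have hc : (0 : ℝ) ≤ (1 + t) ^ (-q) := by positivity
    rw [lintegral_ggMeasure _ _ _ (by fun_prop)]
    rw [← mul_one (ENNReal.ofReal ((1 + t) ^ (-q))), ← lintegral_gammaPDF_eq_one hq0 ht1,
      ← lintegral_const_mul (f := gammaPDF q (1 + t)) _
        (measurable_gammaPDFReal q (1 + t)).ennreal_ofReal,
      ← lintegral_indicator measurableSet_Ioi]
    have h0 : ∀ᵐ x : ℝ, x ≠ 0 := by simp [ae_iff]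
    refine lintegral_congr_ae ?_
    filter_upwards [h0] with x hx
    rw [gammaPDF, gammaPDFReal]
    rcases hx.lt_or_gt with hx | hx
    · simp [hx.not_gt, hx.not_ge]
    · rw [Set.indicator_of_mem (by exact hx), if_pos hx.le, ← ENNReal.ofReal_mul (by positivity),
        ← ENNReal.ofReal_mul hc]
      congr 1
      rw [abs_one, Real.one_rpow, one_mul, one_mul, one_mul, Real.rpow_one, mul_assoc,
        ← Real.exp_add, Real.rpow_neg ht1.le]
      have : (1 + t) ^ q ≠ 0 := by positivity
      field_simp
      ring_nf

/-! ### The law of `Z` and the gamma tail -/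

lemma isProbabilityMeasure_zMeasure {r : ℝ} (hr0 : 0 < r) (hr1 : r ≤ 1) :
    IsProbabilityMeasure (zMeasure r 1) := by
  have := isProbabilityMeasure_gammaLaw hr0.le
  have := isProbabilityMeasure_gammaLaw (sub_nonneg.2 hr1)
  exact Measure.isProbabilityMeasure_map (by fun_prop)

lemma zMeasure_Iic_zero {r : ℝ} (hr0 : 0 < r) (hr1 : r ≤ 1) : zMeasure r 1 (Set.Iic 0) = 0 := by
  have := isProbabilityMeasure_gammaLaw hr0.le
  have := isProbabilityMeasure_gammaLaw (sub_nonneg.2 hr1)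
  rw [zMeasure, Measure.map_apply (by fun_prop) measurableSet_Iic]
  have h1 : ∀ᵐ x ∂gammaLaw r 1, 0 < x := by
    rw [gammaLaw_of_pos hr0]
    exact ae_pos_of_measure_Iic_zero (ggMeasure_Iic_zero _ _ _)
  have h2 : ∀ᵐ x ∂gammaLaw (1 - r) 1, 0 ≤ x := by
    unfold gammaLaw
    split_ifs
    · simp [ae_dirac_eq]
    · filter_upwards [ae_pos_of_measure_Iic_zero (ggMeasure_Iic_zero _ _ _)] with x hx using hx.le
  have h3 := (Measure.quasiMeasurePreserving_fst (ν := gammaLaw (1 - r) 1)).ae h1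
  have h4 := (Measure.quasiMeasurePreserving_snd (μ := gammaLaw r 1)).ae h2
  have h5 : ∀ᵐ p ∂(gammaLaw r 1).prod (gammaLaw (1 - r) 1),
      p ∉ (fun p : ℝ × ℝ => 1 * (p.1 + p.2) / p.1) ⁻¹' Set.Iic 0 := by
    filter_upwards [h3, h4] with p hp hq
    simp only [Set.mem_preimage, Set.mem_Iic, not_le]
    positivity
  exact measure_eq_zero_iff_ae_notMem.2 h5

/-- Given `G = x`, integrating out `G'` yields `exp (-s) * ((x + s) / x) ^ (r - 1)`. Against the
density of `G` the powers of `x` cancel, leaving the Gamma(`r`, 1) density at `x + s`. -/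
lemma lintegral_exp_neg_mul_zMeasure {r s : ℝ} (hr0 : 0 < r) (hr1 : r ≤ 1) (hs : 0 ≤ s) :
    ∫⁻ z, ENNReal.ofReal (Real.exp (-(s * z))) ∂zMeasure r 1 =
      ggMeasure r 1 1 (Set.Ioi s) := by
  have := isProbabilityMeasure_gammaLaw hr0.le
  have := isProbabilityMeasure_gammaLaw (sub_nonneg.2 hr1)
  rw [zMeasure, lintegral_map (by fun_prop) (by fun_prop),
    lintegral_prod _ (by fun_prop)]
  rw [gammaLaw_of_pos hr0, lintegral_ggMeasure]
  swap
  · exact Measurable.lintegral_prod_right' (f := fun p : ℝ × ℝ =>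
      ENNReal.ofReal (Real.exp (-(s * (1 * (p.1 + p.2) / p.1))))) (by fun_prop)
  have hshift : Set.Ioi s = (fun x : ℝ => x + s) '' Set.Ioi 0 := by simp
  rw [ggMeasure_Ioi _ _ _ hs, hshift, lintegral_image_eq_lintegral_abs_deriv_mul (f' := fun _ => 1)
    measurableSet_Ioi (fun x _ => ((hasDerivAt_id' x).add_const s).hasDerivWithinAt)
    (add_left_injective s).injOn]
  refine setLIntegral_congr_fun measurableSet_Ioi fun x (hx : 0 < x) => ?_
  have h1 : ∀ y : ℝ, ENNReal.ofReal (Real.exp (-(s * (1 * (x + y) / x)))) =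
      ENNReal.ofReal (Real.exp (-s)) * ENNReal.ofReal (Real.exp (-(s / x * y))) := fun y => by
    rw [← ENNReal.ofReal_mul (Real.exp_pos _).le, ← Real.exp_add]
    congr 2
    field_simp
    ring
  have hΓ := Real.Gamma_pos_of_pos hr0
  simp only [h1]
  rw [lintegral_const_mul _ (by fun_prop),
    lintegral_exp_neg_mul_gammaLaw (sub_nonneg.2 hr1) (by positivity),
    ← ENNReal.ofReal_mul (Real.exp_pos _).le, ← ENNReal.ofReal_mul (by positivity),
    abs_one, ENNReal.ofReal_one, one_mul]
  have h2 : 1 + s / x = (x + s) / x := by field_simp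
  rw [h2, Real.div_rpow (by positivity) hx.le, neg_sub, one_mul, Real.one_rpow, Real.rpow_one,
    Real.rpow_one, one_mul, one_mul, one_mul, neg_add, Real.exp_add]
  have : x ^ (r - 1) ≠ 0 := (Real.rpow_pos_of_pos hx _).ne'
  field_simp

/-! ### Mixture representation of the tail -/

lemma limitLaw_Ici {r α γ lam x : ℝ} (hαγ : 0 < α * γ) (hlam : 0 < lam) (hx : 0 ≤ x) :
    limitLaw r α γ lam (Set.Ici x) = ∫⁻ w, ggMeasure r 1 1
      (Set.Ioi (lam * (x * w) ^ (α * γ))) ∂weibullMeasure α := by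
  have : SFinite (weibullMeasure α) := sfinite_ggMeasure _ _ _
  rw [limitLaw, Measure.map_apply (by fun_prop) measurableSet_Ici,
    Measure.prod_apply_symm ((by fun_prop : Measurable fun p : ℝ × ℝ => p.1 / p.2)
      measurableSet_Ici)]
  refine lintegral_congr_ae ?_
  filter_upwards [ae_pos_of_measure_Iic_zero (ggMeasure_Iic_zero 1 α 1)] with w hw
  rw [← ggMeasure_Ioi_eq_gamma hαγ hlam (by positivity), ← measure_congr Ioi_ae_eq_Ici.symm]
  congr 1 with g
  simp [le_div_iff₀ hw]

lemma lintegral_map_exp_neg_mul {Ω : Type*} [MeasurableSpace Ω] {P : Measure Ω}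
    [IsProbabilityMeasure P] {r α γ lam x : ℝ} (hr0 : 0 < r) (hr1 : r ≤ 1) (hlam : 0 < lam)
    (hαγ0 : 0 < α * γ) (hαγ1 : α * γ ≤ 1) {ν : Measure ℝ}
    (hν : IsPositiveStrictlyStable (α * γ) ν) {W S Z : Ω → ℝ}
    (hW : HasLaw W (weibullMeasure α) P) (hS : HasLaw S ν P) (hZ : HasLaw Z (zMeasure r 1) P)
    (hindep : iIndepFun ![W, S, Z] P) (hx : 0 ≤ x) :
    ∫⁻ u, ENNReal.ofReal (Real.exp (-(u * x)))
      ∂(P.map fun ω => lam ^ (1 / (α * γ)) * W ω * S ω * Z ω ^ (1 / (α * γ))) =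
    limitLaw r α γ lam (Set.Ici x) := by
  have := hν.isProbabilityMeasure
  have := isProbabilityMeasure_zMeasure hr0 hr1
  have : SFinite (weibullMeasure α) := sfinite_ggMeasure _ _ _
  have hWm := hW.aemeasurable
  have hSm := hS.aemeasurable
  have hZm := hZ.aemeasurable
  have hm : ∀ i, AEMeasurable (![W, S, Z] i) P := by
    intro i; fin_cases i <;> assumption
  have hWZ : IndepFun W Z P := hindep.indepFun (i := 0) (j := 2) (by decide)
  -- Pairing `W` with `Z` makes `S` the innermost variable of integration, so its Laplace transform
  -- applies at fixed `w` and `z`.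
  have hWZS : IndepFun (fun ω => (W ω, Z ω)) S P :=
    hindep.indepFun_prodMk₀ hm 0 2 1 (by decide) (by decide)
  have hlaw : P.map (fun ω => ((W ω, Z ω), S ω)) =
      ((weibullMeasure α).prod (zMeasure r 1)).prod ν := by
    rw [(indepFun_iff_map_prod_eq_prod_map_map (hWm.prodMk hZm) hSm).1 hWZS,
      (indepFun_iff_map_prod_eq_prod_map_map hWm hZm).1 hWZ, hW.map_eq, hZ.map_eq, hS.map_eq]
  set δ := α * γ with hδ
  have hmap : P.map (fun ω => lam ^ (1 / δ) * W ω * S ω * Z ω ^ (1 / δ)) =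
      (((weibullMeasure α).prod (zMeasure r 1)).prod ν).map
        fun p => lam ^ (1 / δ) * p.1.1 * p.2 * p.1.2 ^ (1 / δ) := by
    rw [← hlaw, AEMeasurable.map_map_of_aemeasurable (by fun_prop) (by fun_prop)]
    rfl
  rw [hmap, lintegral_map (by fun_prop) (by fun_prop), lintegral_prod _ (by fun_prop),
    lintegral_prod _ (Measurable.lintegral_prod_right' (f := fun p : (ℝ × ℝ) × ℝ =>
      ENNReal.ofReal (Real.exp (-(lam ^ (1 / δ) * p.1.1 * p.2 * p.1.2 ^ (1 / δ) * x))))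
      (by fun_prop)).aemeasurable, limitLaw_Ici hαγ0 hlam hx]
  refine lintegral_congr_ae ?_
  filter_upwards [ae_pos_of_measure_Iic_zero (ggMeasure_Iic_zero 1 α 1)] with w hw
  rw [← lintegral_exp_neg_mul_zMeasure hr0 hr1 (by positivity)]
  refine lintegral_congr_ae ?_
  filter_upwards [ae_pos_of_measure_Iic_zero (zMeasure_Iic_zero hr0 hr1)] with z hz
  have h1 : ∀ s : ℝ, lam ^ (1 / δ) * w * s * z ^ (1 / δ) * x =
      lam ^ (1 / δ) * z ^ (1 / δ) * (x * w) * s := fun s => by ring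
  simp only [h1]
  rw [hν.lintegral_exp_neg_mul hαγ0 hαγ1 (by positivity),
    Real.mul_rpow (by positivity) (by positivity), Real.mul_rpow (by positivity) (by positivity),
    one_div, Real.rpow_inv_rpow hlam.le hαγ0.ne', Real.rpow_inv_rpow hz.le hαγ0.ne']
  congr 3
  ring

lemma isProbabilityMeasure_limitLaw {r α γ lam : ℝ} (hr0 : 0 < r) (hlam : 0 < lam)
    (hα : 0 < α) (hαγ : 0 < α * γ) : IsProbabilityMeasure (limitLaw r α γ lam) := by
  have := isProbabilityMeasure_ggMeasure hr0 hαγ hlam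
  have : IsProbabilityMeasure (weibullMeasure α) :=
    isProbabilityMeasure_ggMeasure one_pos hα one_pos
  exact Measure.isProbabilityMeasure_map (by fun_prop)

end MixedExp

theorem theorem3 {Ω : Type*} [MeasurableSpace Ω] (P : Measure Ω) [IsProbabilityMeasure P]
    (r α γ lam : ℝ) (hr0 : 0 < r) (hr1 : r ≤ 1) (hlam : 0 < lam)
    (hα : 0 < α) (hαγ0 : 0 < α * γ) (hαγ1 : α * γ ≤ 1)
    (ν : Measure ℝ) (hν : MixedExp.IsPositiveStrictlyStable (α * γ) ν)
    (W S Z : Ω → ℝ)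
    (hW : HasLaw W (MixedExp.weibullMeasure α) P)
    (hS : HasLaw S ν P)
    (hZ : HasLaw Z (MixedExp.zMeasure r 1) P)
    (hindep : iIndepFun ![W, S, Z] P) :
    MixedExp.IsMixedExponential (fun x => MixedExp.limitDF r α γ lam x)
      (P.map fun ω => lam ^ (1 / (α * γ)) * W ω * S ω * Z ω ^ (1 / (α * γ))) := by
  have hWm := hW.aemeasurable
  have hSm := hS.aemeasurable
  have hZm := hZ.aemeasurable
  have hm : AEMeasurable (fun ω => lam ^ (1 / (α * γ)) * W ω * S ω * Z ω ^ (1 / (α * γ))) P := by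
    fun_prop
  have hlim := MixedExp.isProbabilityMeasure_limitLaw hr0 hlam hα hαγ0
  have hA : IsProbabilityMeasure
      (P.map fun ω => lam ^ (1 / (α * γ)) * W ω * S ω * Z ω ^ (1 / (α * γ))) :=
    Measure.isProbabilityMeasure_map hm
  have hpos : (P.map fun ω => lam ^ (1 / (α * γ)) * W ω * S ω * Z ω ^ (1 / (α * γ)))
      (Set.Iic 0) = 0 := by
    rw [Measure.map_apply_of_aemeasurable hm measurableSet_Iic, measure_eq_zero_iff_ae_notMem]
    have h1 := MixedExp.ae_pos_of_measure_Iic_zero (MixedExp.ggMeasure_Iic_zero 1 α 1)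
    have h2 := MixedExp.ae_pos_of_measure_Iic_zero hν.positive
    have h3 := MixedExp.ae_pos_of_measure_Iic_zero (MixedExp.zMeasure_Iic_zero hr0 hr1)
    filter_upwards [(hW.ae_iff measurableSet_Ioi.mem).2 h1, (hS.ae_iff measurableSet_Ioi.mem).2 h2,
      (hZ.ae_iff measurableSet_Ioi.mem).2 h3] with ω h1 h2 h3
    have h1 : 0 < W ω := h1
    have h2 : 0 < S ω := h2
    have h3 : 0 < Z ω := h3
    simp only [Set.mem_preimage, Set.mem_Iic, not_le]
    positivity
  have htail : ∀ x : ℝ, 0 ≤ x → 1 - MixedExp.limitDF r α γ lam x = ∫ u in Set.Ici (0 : ℝ),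
      Real.exp (-(u * x))
        ∂(P.map fun ω => lam ^ (1 / (α * γ)) * W ω * S ω * Z ω ^ (1 / (α * γ))) := by
    intro x hx
    -- The mixing law charges only `(0, ∞)`, so restricting it to `[0, ∞)` changes nothing.
    rw [Measure.restrict_eq_self_of_ae_mem (s := Set.Ici (0 : ℝ)),
      integral_eq_lintegral_of_nonneg_ae (ae_of_all _ fun _ => (Real.exp_pos _).le) (by fun_prop),
      MixedExp.lintegral_map_exp_neg_mul hr0 hr1 hlam hαγ0 hαγ1 hν hW hS hZ hindep hx,
      MixedExp.limitDF, ← probReal_compl_eq_one_sub measurableSet_Iio, Set.compl_Iio]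
    · rfl
    · filter_upwards [MixedExp.ae_pos_of_measure_Iic_zero hpos] with u hu using hu.le
  refine ⟨hA, hpos, fun x hx => ?_, htail⟩
  -- The tail formula at 0 is the total mass of the mixing law, hence `F 0 = 0`; monotonicity then
  -- covers negative `x`.
  have h0 : MixedExp.limitDF r α γ lam 0 = 0 := by
    have h := htail 0 le_rfl
    rw [Measure.restrict_eq_self_of_ae_mem (s := Set.Ici (0 : ℝ))] at h
    · simp only [mul_zero, neg_zero, Real.exp_zero, integral_const, probReal_univ, smul_eq_mul,
        mul_one] at h
      linarith
    · filter_upwards [MixedExp.ae_pos_of_measure_Iic_zero hpos] with u hu using hu.le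
  refine le_antisymm ?_ measureReal_nonneg
  rw [← h0]
  exact measureReal_mono (Set.Iio_subset_Iio hx.le)
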